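/- Permutations are multiplied from left to right. A finite sequence $a_1,\dots,a_n$ of elements of a group $G$ is an \emph{Ordered Generating System} (OGS) of $G$ with bounds $m_1,\dots,m_n\in\mathbb{Z}_{\ge 0}$ if every $g\in G$ has a unique representation $g=a_1^{i_1}a_2^{i_2}\cdots a_n^{i_n}$ with $0\le i_k\le m_k$ for all $k$; $G$ \emph{has an OGS} if such a sequence exists for some bounds. Let $M_{22}\le S_{22}$ be the Mathieu group generated by $$X=(1,2,3,4,5,6,7,8,9,10,11)(12,13,14,15,16,17,18,19,20,21,22),$$ $$Y=(1,4,5,9,3)(2,8,10,7,6)(12,15,16,20,14)(13,19,21,18,17),$$ $$V=(11,22)(1,21)(2,10,8,6)(12,14,16,20)(3,13,4,17)(5,19,9,18),$$ and let $H\le M_{22}$ be the stabilizer of the point $22$. Theorem 5. The group $M_{22}$ has order $443520$, $H$ is isomorphic to $PSL_3(4)$, and $H$ has an OGS. The $22$ elements $V^iX^j$ with $0\le i\le 1$, $0\le j\le 10$ take the point $22$ to the $22$ different points, and every element of $M_{22}$ has a unique representation $h\,V^iX^j$ with $h\in H$, $0\le i\le 1$, $0\le j\le 10$. If $a_1,\dots,a_n$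 is an OGS of $H$ with bounds $m_1,\dots,m_n$, then $a_1,\dots,a_n,V,X$ is an OGS of $M_{22}$ with bounds $m_1,\dots,m_n,1,10$. In particular, $M_{22}$ has an OGS. -/

import Mathlib

/-- `a₁, …, aₙ` is an ordered generating system of `G` with exponent bounds `m₁, …, mₙ`: every
element of `G` has exactly one representation `a₁ ^ i₁ * ⋯ * aₙ ^ iₙ` with `0 ≤ iₖ ≤ mₖ`. -/
def IsOGSWith {G : Type*} [Group G] {n : ℕ} (a : Fin n → G) (m : Fin n → ℕ) : Prop :=
  ∀ g : G, ∃! i : Fin n → ℕ, (∀ k, i k ≤ m k) ∧ g = (List.ofFn fun k => a k ^ i k).prod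

/-- `G` has an ordered generating system (for some exponent bounds). -/
def HasOGS (G : Type*) [Group G] : Prop :=
  ∃ (n : ℕ) (a : Fin n → G) (m : Fin n → ℕ), IsOGSWith a m

/-- The symmetric group on 22 points with permutations multiplied from left to right: in `f * g`
the permutation `f` is applied first. (`Equiv.Perm` multiplies the other way, hence the opposite.)
The point labelled `k`, for `1 ≤ k ≤ 22`, is the numeral `k : Fin 22`; as numerals in `Fin 22` are
read modulo 22, the point labelled `22` is `0`. -/
abbrev S22 : Type := (Equiv.Perm (Fin 22))ᵐᵒᵖ

/-- The image of the point `x` under the permutation `g`. -/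
def S22.image (x : Fin 22) (g : S22) : Fin 22 := g.unop x

/-- `X = (1,2,…,11)(12,13,…,22)`. -/
def permX : S22 := MulOpposite.op
  (c[(1 : Fin 22), 2, 3, 4, 5, 6, 7, 8, 9, 10, 11] *
    c[(12 : Fin 22), 13, 14, 15, 16, 17, 18, 19, 20, 21, 22])

/-- `Y = (1,4,5,9,3)(2,8,10,7,6)(12,15,16,20,14)(13,19,21,18,17)`. -/
def permY : S22 := MulOpposite.op
  (c[(1 : Fin 22), 4, 5, 9, 3] * c[(2 : Fin 22), 8, 10, 7, 6] *
    c[(12 : Fin 22), 15, 16, 20, 14] * c[(13 : Fin 22), 19, 21, 18, 17])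

/-- `V = (11,22)(1,21)(2,10,8,6)(12,14,16,20)(3,13,4,17)(5,19,9,18)`. -/
def permV : S22 := MulOpposite.op
  (c[(11 : Fin 22), 22] * c[(1 : Fin 22), 21] * c[(2 : Fin 22), 10, 8, 6] *
    c[(12 : Fin 22), 14, 16, 20] * c[(3 : Fin 22), 13, 4, 17] * c[(5 : Fin 22), 19, 9, 18])

/-- The Mathieu group `M₂₂`, as the subgroup of `S₂₂` generated by `X`, `Y` and `V`. -/
def M22 : Subgroup S22 := Subgroup.closure {permX, permY, permV}

/-- `X` as an element of `M₂₂`. -/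
def M22.X : M22 := ⟨permX, Subgroup.subset_closure (by simp)⟩

/-- `V` as an element of `M₂₂`. -/
def M22.V : M22 := ⟨permV, Subgroup.subset_closure (by simp)⟩

/-- The stabilizer of the point `22` in `M₂₂`. -/
def M22.stab22 : Subgroup M22 where
  carrier := {g | S22.image 22 (g : S22) = 22}
  one_mem' := rfl
  mul_mem' {f g} hf hg := by
    change (g : S22).unop ((f : S22).unop 22) = 22
    rw [show (f : S22).unop 22 = 22 from hf]
    exact hg
  inv_mem' {g} hg := by
    change ((g : S22).unop)⁻¹ 22 = 22
    rw [Equiv.Perm.inv_eq_iff_eq]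
    exact (show (g : S22).unop 22 = 22 from hg).symm

/-- The field with four elements `0, 1, ω, ω + 1`, as a type on which everything is computable. -/
inductive F4 : Type
  | zero | one | omega | omegaSq
  deriving DecidableEq

namespace F4

instance : Fintype F4 where
  elems := {zero, one, omega, omegaSq}
  complete x := by cases x <;> decide

/-- Addition of the field with four elements. -/
def add : F4 → F4 → F4
  | zero, b => b
  | a, zero => a
  | one, one => zero
  | one, omega => omegaSq
  | one, omegaSq => omega
  | omega, one => omegaSq
  | omega, omega => zero
  | omega, omegaSq => one
  | omegaSq, one => omega
  | omegaSq, omega => one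
  | omegaSq, omegaSq => zero

/-- Multiplication of the field with four elements. -/
def mul : F4 → F4 → F4
  | zero, _ => zero
  | _, zero => zero
  | one, b => b
  | a, one => a
  | omega, omega => omegaSq
  | omega, omegaSq => one
  | omegaSq, omega => one
  | omegaSq, omegaSq => omega

/-- Inversion in the field with four elements. -/
def inv : F4 → F4
  | zero => zero
  | one => one
  | omega => omegaSq
  | omegaSq => omega

instance : Zero F4 := ⟨zero⟩

instance : One F4 := ⟨one⟩

instance : Add F4 := ⟨add⟩

instance : Mul F4 := ⟨mul⟩

instance : Neg F4 := ⟨id⟩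

instance : Inv F4 := ⟨inv⟩

instance : Field F4 where
  add_assoc := by decide
  zero_add := by decide
  add_zero := by decide
  add_comm := by decide
  neg_add_cancel := by decide
  mul_assoc := by decide
  one_mul := by decide
  mul_one := by decide
  mul_comm := by decide
  zero_mul := by decide
  mul_zero := by decide
  left_distrib := by decide
  right_distrib := by decide
  exists_pair_ne := ⟨zero, one, by decide⟩
  mul_inv_cancel := by decide
  inv_zero := rfl
  nsmul := nsmulRec
  zsmul := zsmulRec
  nnqsmul := _
  nnqsmul_def := fun _ _ => rfl
  qsmul := _
  qsmul_def := fun _ _ => rfl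

theorem card_eq : Fintype.card F4 = 4 := rfl

/-- The element whose number is the last base-4 digit of `n`. -/
def ofDigit (n : ℕ) : F4 :=
  match n % 4 with
  | 0 => zero
  | 1 => one
  | 2 => omega
  | _ => omegaSq

theorem pow_three_of_ne_zero : ∀ {c : F4}, c ≠ 0 → c ^ 3 = 1 := by
  have : ∀ c : F4, c ≠ 0 → c * (c * c) = 1 := by decide
  intro c hc
  rw [← this c hc]; ring

end F4

open Matrix in
theorem card_SL3_F4 : Nat.card (SpecialLinearGroup (Fin 3) F4) = 60480 := by
  have hrange : Set.range (SpecialLinearGroup.toGL (n := Fin 3) (R := F4)) =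
      ((GeneralLinearGroup.det (n := Fin 3) (R := F4)).ker : Set (GL (Fin 3) F4)) := by
    ext A
    constructor
    · rintro ⟨B, rfl⟩
      simp [MonoidHom.mem_ker]
    · intro hA
      have hA' : (A : Matrix (Fin 3) (Fin 3) F4).det = 1 := congrArg Units.val hA
      exact ⟨⟨A, hA'⟩, Units.ext rfl⟩
  have h1 : Nat.card (SpecialLinearGroup (Fin 3) F4) =
      Nat.card (GeneralLinearGroup.det (n := Fin 3) (R := F4)).ker := by
    rw [← SetLike.coe_sort_coe, ← hrange]
    exact Nat.card_congr (Equiv.ofInjective _ SpecialLinearGroup.toGL_injective)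
  have h2 := Subgroup.card_eq_card_quotient_mul_card_subgroup
    (GeneralLinearGroup.det (n := Fin 3) (R := F4)).ker
  have hsurj : Function.Surjective (GeneralLinearGroup.det (n := Fin 3) (R := F4)) := by
    intro u
    refine ⟨GeneralLinearGroup.mk'' (diagonal ![(u : F4), 1, 1]) ?_, ?_⟩
    · simp [det_diagonal, Fin.prod_univ_three]
    · ext
      change (diagonal ![(u : F4), 1, 1]).det = u
      simp [det_diagonal, Fin.prod_univ_three]
  rw [card_GL_field, Nat.card_congr
    (QuotientGroup.quotientKerEquivOfSurjective _ hsurj).toEquiv, ← h1,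
    Nat.card_eq_fintype_card, Fintype.card_units, F4.card_eq, Fin.prod_univ_three] at h2
  simp [-Nat.card_eq_fintype_card] at h2
  omega

theorem card_center_SL3_F4 :
    Nat.card (Subgroup.center (Matrix.SpecialLinearGroup (Fin 3) F4)) = 3 := by
  rw [Nat.card_congr (Matrix.SpecialLinearGroup.center_equiv_rootsOfUnity' (0 : Fin 3)).toEquiv]
  have : rootsOfUnity (Fintype.card (Fin 3)) F4 = ⊤ := by
    ext u
    simp only [mem_rootsOfUnity, Subgroup.mem_top, iff_true, Fintype.card_fin]
    exact Units.ext (F4.pow_three_of_ne_zero u.ne_zero)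
  rw [this, Subgroup.card_top, Nat.card_eq_fintype_card, Fintype.card_units, F4.card_eq]

theorem card_PSL3_F4 :
    Nat.card (Matrix.ProjectiveSpecialLinearGroup (Fin 3) F4) = 20160 := by
  have h := Subgroup.card_eq_card_quotient_mul_card_subgroup
    (Subgroup.center (Matrix.SpecialLinearGroup (Fin 3) F4))
  rw [card_SL3_F4, card_center_SL3_F4] at h
  change 60480 = Nat.card (Matrix.ProjectiveSpecialLinearGroup (Fin 3) F4) * 3 at h
  omega

/-- Isomorphic rings have isomorphic special linear groups. -/
def Matrix.SpecialLinearGroup.congrRingEquiv {n R S : Type*} [Fintype n] [DecidableEq n]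
    [CommRing R] [CommRing S] (e : R ≃+* S) :
    SpecialLinearGroup n R ≃* SpecialLinearGroup n S :=
  MonoidHom.toMulEquiv (SpecialLinearGroup.map (e : R →+* S))
    (SpecialLinearGroup.map (e.symm : S →+* R)) (by ext; simp) (by ext; simp)

theorem Subgroup.map_center_mulEquiv {G G' : Type*} [Group G] [Group G'] (e : G ≃* G') :
    (Subgroup.center G).map (e : G →* G') = Subgroup.center G' := by
  ext g
  rw [show g ∈ (Subgroup.center G).map (e : G →* G') ↔ _ from Subgroup.mem_map_equiv,
    Subgroup.mem_center_iff, Subgroup.mem_center_iff]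
  constructor
  · intro h x
    apply e.symm.injective
    simpa using h (e.symm x)
  · intro h x
    apply e.injective
    simpa using h (e x)

/-- Isomorphic rings have isomorphic projective special linear groups. -/
def Matrix.ProjectiveSpecialLinearGroup.congrRingEquiv {n R S : Type*} [Fintype n]
    [DecidableEq n] [CommRing R] [CommRing S] (e : R ≃+* S) :
    ProjectiveSpecialLinearGroup n R ≃* ProjectiveSpecialLinearGroup n S :=
  QuotientGroup.congr _ _ (SpecialLinearGroup.congrRingEquiv e)
    (Subgroup.map_center_mulEquiv _)

theorem nonempty_ringEquiv_F4_galoisField : Nonempty (F4 ≃+* GaloisField 2 2) := by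
  have : Fintype (GaloisField 2 2) := Fintype.ofFinite _
  refine ⟨FiniteField.ringEquivOfCardEq ?_⟩
  rw [F4.card_eq, ← Nat.card_eq_fintype_card, GaloisField.card 2 2 two_ne_zero]
  rfl

section PlaneAction

open Matrix

/-- Homogeneous coordinates of the point `k` for `1 ≤ k ≤ 21`, and the zero vector for `k = 0`,
packed as three base-4 digits. -/
def pointCode : Fin 22 → ℕ :=
  ![0, 1, 4, 16, 17, 18, 20, 29, 6, 19, 23, 30, 7, 21, 24, 28, 5, 22, 27, 25, 26, 31]

/-- Homogeneous coordinates in the projective plane over `F4` of the point `k` for `1 ≤ k ≤ 21`,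
and the zero vector for `k = 0`. -/
def pointVec (k : Fin 22) : Fin 3 → F4 :=
  ![F4.ofDigit (pointCode k / 16), F4.ofDigit (pointCode k / 4), F4.ofDigit (pointCode k)]

/-- The label of the point with homogeneous coordinates `(a, b, c)`. -/
def pointLabel : F4 → F4 → F4 → Fin 22
  | .zero, .zero, .zero => 0
  | .zero, .zero, _ => 1
  | .zero, b, c =>
    match c * b⁻¹ with
    | .zero => 2
    | .one => 16
    | .omega => 8
    | .omegaSq => 12
  | a, b, c =>
    match b * a⁻¹, c * a⁻¹ with
    | .zero, .zero => 3
    | .zero, .one => 4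
    | .zero, .omega => 5
    | .zero, .omegaSq => 9
    | .one, .zero => 6
    | .one, .one => 13
    | .one, .omega => 17
    | .one, .omegaSq => 10
    | .omega, .zero => 14
    | .omega, .one => 19
    | .omega, .omega => 20
    | .omega, .omegaSq => 18
    | .omegaSq, .zero => 15
    | .omegaSq, .one => 7
    | .omegaSq, .omega => 11
    | .omegaSq, .omegaSq => 21

theorem pointLabel_mul : ∀ r a b c : F4, r ≠ 0 →
    pointLabel (r * a) (r * b) (r * c) = pointLabel a b c := by decide +kernel

theorem pointLabel_pointVec : ∀ k : Fin 22,
    pointLabel (pointVec k 0) (pointVec k 1) (pointVec k 2) = k := by decide +kernel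

theorem exists_pointVec_pointLabel : ∀ a b c : F4, ∃ r : F4, r ≠ 0 ∧
    r * pointVec (pointLabel a b c) 0 = a ∧ r * pointVec (pointLabel a b c) 1 = b ∧
    r * pointVec (pointLabel a b c) 2 = c := by decide +kernel

/-- The label of the point with homogeneous coordinates `w`. -/
def vecLabel (w : Fin 3 → F4) : Fin 22 := pointLabel (w 0) (w 1) (w 2)

theorem vecLabel_smul {r : F4} (hr : r ≠ 0) (w : Fin 3 → F4) : vecLabel (r • w) = vecLabel w :=
  pointLabel_mul r _ _ _ hr

theorem vecLabel_pointVec (k : Fin 22) : vecLabel (pointVec k) = k := pointLabel_pointVec k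

theorem exists_smul_pointVec_vecLabel (w : Fin 3 → F4) :
    ∃ r : F4, r ≠ 0 ∧ r • pointVec (vecLabel w) = w := by
  obtain ⟨r, hr, h0, h1, h2⟩ := exists_pointVec_pointLabel (w 0) (w 1) (w 2)
  refine ⟨r, hr, ?_⟩
  ext j
  fin_cases j
  · exact h0
  · exact h1
  · exact h2

/-- The map on the labels induced by a matrix acting on row vectors. -/
def matrixAct (A : Matrix (Fin 3) (Fin 3) F4) (k : Fin 22) : Fin 22 :=
  pointLabel (pointVec k 0 * A 0 0 + pointVec k 1 * A 1 0 + pointVec k 2 * A 2 0)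
    (pointVec k 0 * A 0 1 + pointVec k 1 * A 1 1 + pointVec k 2 * A 2 1)
    (pointVec k 0 * A 0 2 + pointVec k 1 * A 1 2 + pointVec k 2 * A 2 2)

theorem matrixAct_eq (A : Matrix (Fin 3) (Fin 3) F4) (k : Fin 22) :
    matrixAct A k = vecLabel (pointVec k ᵥ* A) := by
  simp [matrixAct, vecLabel, vecMul, dotProduct, Fin.sum_univ_three]

theorem matrixAct_one (k : Fin 22) : matrixAct 1 k = k := by
  rw [matrixAct_eq, vecMul_one, vecLabel_pointVec]

theorem matrixAct_mul (A B : Matrix (Fin 3) (Fin 3) F4) (k : Fin 22) :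
    matrixAct (A * B) k = matrixAct B (matrixAct A k) := by
  obtain ⟨r, hr, h⟩ := exists_smul_pointVec_vecLabel (pointVec k ᵥ* A)
  rw [matrixAct_eq, matrixAct_eq B, matrixAct_eq A, ← vecMul_vecMul, ← h, smul_vecMul,
    vecLabel_smul hr, vecLabel_smul hr, vecLabel_pointVec]

/-- The action of `SL₃(4)` on the points of the projective plane, as permutations fixing the
point `22`. -/
def planeHom : Matrix.SpecialLinearGroup (Fin 3) F4 →* S22 where
  toFun A := MulOpposite.op
    { toFun := matrixAct A
      invFun := matrixAct (A⁻¹ : Matrix.SpecialLinearGroup (Fin 3) F4)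
      left_inv := fun k => by
        rw [← matrixAct_mul, ← Matrix.SpecialLinearGroup.coe_mul, mul_inv_cancel,
          Matrix.SpecialLinearGroup.coe_one, matrixAct_one]
      right_inv := fun k => by
        rw [← matrixAct_mul, ← Matrix.SpecialLinearGroup.coe_mul, inv_mul_cancel,
          Matrix.SpecialLinearGroup.coe_one, matrixAct_one] }
  map_one' := by
    apply MulOpposite.unop_injective
    ext1 k
    exact matrixAct_one k
  map_mul' A B := by
    apply MulOpposite.unop_injective
    ext1 k
    exact matrixAct_mul A.1 B.1 k

theorem image_planeHom (A : Matrix.SpecialLinearGroup (Fin 3) F4) (k : Fin 22) :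
    S22.image k (planeHom A) = matrixAct A k := rfl

theorem S22.ext_image {f g : S22} (h : ∀ k, S22.image k f = S22.image k g) : f = g :=
  MulOpposite.unop_injective (Equiv.ext h)

theorem mem_ker_planeHom_iff (A : Matrix.SpecialLinearGroup (Fin 3) F4) :
    A ∈ planeHom.ker ↔ ∀ k, ∃ r : F4, r ≠ 0 ∧
    pointVec k ᵥ* (A : Matrix _ _ F4) = r • pointVec k := by
  have : A ∈ planeHom.ker ↔ ∀ k, matrixAct A k = k :=
    ⟨fun h k => congrArg (S22.image k) h, fun h => S22.ext_image h⟩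
  rw [this]
  refine forall_congr' fun k => ⟨fun h => ?_, ?_⟩
  · obtain ⟨r, hr, h'⟩ := exists_smul_pointVec_vecLabel (pointVec k ᵥ* (A : Matrix _ _ F4))
    rw [← matrixAct_eq, h] at h'
    exact ⟨r, hr, h'.symm⟩
  · rintro ⟨r, hr, h⟩
    rw [matrixAct_eq, h, vecLabel_smul hr, vecLabel_pointVec]

theorem ker_planeHom : planeHom.ker = Subgroup.center (Matrix.SpecialLinearGroup (Fin 3) F4) := by
  ext A
  rw [mem_ker_planeHom_iff, Matrix.SpecialLinearGroup.mem_center_iff]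
  constructor
  · intro h
    have v1 : pointVec 1 = ![0, 0, 1] := by decide
    have v2 : pointVec 2 = ![0, 1, 0] := by decide
    have v3 : pointVec 3 = ![1, 0, 0] := by decide
    have v13 : pointVec 13 = ![1, 1, 1] := by decide
    obtain ⟨c, hc, h1⟩ := h 1
    obtain ⟨b, hb, h2⟩ := h 2
    obtain ⟨a, ha, h3⟩ := h 3
    obtain ⟨r, hr, h4⟩ := h 13
    rw [v1] at h1
    rw [v2] at h2
    rw [v3] at h3
    rw [v13] at h4
    simp only [funext_iff, Fin.forall_fin_succ, vecMul, dotProduct, Fin.sum_univ_three]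
      at h1 h2 h3 h4
    simp at h1 h2 h3 h4
    refine ⟨r, F4.pow_three_of_ne_zero hr, ?_⟩
    ext i j
    fin_cases i <;> fin_cases j <;> simp_all
  · rintro ⟨r, hr, h⟩ k
    refine ⟨r, ?_, ?_⟩
    · rintro rfl
      simp at hr
    · rw [← h, scalar_apply, ← smul_one_eq_diagonal, vecMul_smul, vecMul_one]

theorem card_range_planeHom : Nat.card planeHom.range = 20160 := by
  rw [← Nat.card_congr (QuotientGroup.quotientKerEquivRange planeHom).toEquiv, ker_planeHom]
  exact card_PSL3_F4

theorem image_zero_planeHom (A : Matrix.SpecialLinearGroup (Fin 3) F4) :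
    S22.image 22 (planeHom A) = 22 := by
  rw [image_planeHom, matrixAct_eq]
  have : pointVec 22 = 0 := by decide
  rw [this, zero_vecMul]
  rfl

end PlaneAction

namespace S22

theorem image_mul (x : Fin 22) (f g : S22) : image x (f * g) = image (image x f) g := rfl

theorem image_pow (x : Fin 22) (f : S22) (n : ℕ) :
    image x (f ^ n) = (fun y => image y f)^[n] x := by
  induction n generalizing x with
  | zero => rfl
  | succ n ih => rw [pow_succ', image_mul, ih, Function.iterate_succ_apply]

theorem image_injective (g : S22) : Function.Injective fun x => image x g := g.unop.injective

/-- If all `f a` fix the point `x` and the `h b` take `x` to different points, then the products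
`f a * h b` are different as soon as the `f a` are. -/
theorem mul_injective_of_image {α β : Type*} {f : α → S22} {h : β → S22} (x : Fin 22)
    (hf : Function.Injective f) (hfx : ∀ a, image x (f a) = x)
    (hh : Function.Injective fun b => image x (h b)) :
    Function.Injective fun p : α × β => f p.1 * h p.2 := by
  rintro ⟨a, b⟩ ⟨a', b'⟩ hab
  have hab' : f a * h b = f a' * h b' := hab
  have hb : b = b' := hh <| by
    have := congrArg (image x) hab'
    rwa [image_mul, image_mul, hfx, hfx] at this
  subst hb
  rw [hf (mul_right_cancel hab')]

end S22

/-- The map of `Fin 22` that takes `x` to the digit number `x` of `n` in base 32. -/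
def packedTable (n : ℕ) (x : Fin 22) : Fin 22 := Fin.ofNat 22 (n / 32 ^ (x : ℕ) % 32)

/-- The table of images under `X`. -/
def tableX : Fin 22 → Fin 22 := packedTable 27437182606396244215107324873804

/-- The table of images under `Y`. -/
def tableY : Fin 22 → Fin 22 := packedTable 748767322532729009538897550549120

/-- The table of images under `V`. -/
def tableV : Fin 22 → Fin 22 := packedTable 56139483662684953760233172675243

theorem image_permX : ∀ k, S22.image k permX = tableX k := by decide +kernel

theorem image_permY : ∀ k, S22.image k permY = tableY k := by decide +kernel

theorem image_permV : ∀ k, S22.image k permV = tableV k := by decide +kernel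

theorem image_permX_pow (x : Fin 22) (n : ℕ) : S22.image x (permX ^ n) = tableX^[n] x := by
  rw [S22.image_pow, funext image_permX]

theorem image_permY_pow (x : Fin 22) (n : ℕ) : S22.image x (permY ^ n) = tableY^[n] x := by
  rw [S22.image_pow, funext image_permY]

theorem image_permV_pow (x : Fin 22) (n : ℕ) : S22.image x (permV ^ n) = tableV^[n] x := by
  rw [S22.image_pow, funext image_permV]

/-- The image of `x` under `V ^ i * X ^ j`. -/
def tableVX (i j : ℕ) (x : Fin 22) : Fin 22 := tableX^[j] (tableV^[i] x)

theorem image_permV_pow_mul_permX_pow (x : Fin 22) (i j : ℕ) :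
    S22.image x (permV ^ i * permX ^ j) = tableVX i j x := by
  rw [S22.image_mul, image_permX_pow, image_permV_pow, tableVX]

/-- The exponents `(i, j)` for which `V ^ i * X ^ j` takes the point `22` to `x`. -/
def cosetIndex (x : Fin 22) : Fin 2 × Fin 11 :=
  (if 1 ≤ x ∧ x ≤ 11 then 1 else 0, Fin.ofNat 11 x)

theorem tableVX_bijective :
    Function.Bijective fun p : Fin 2 × Fin 11 => tableVX p.1 p.2 22 :=
  Function.bijective_iff_has_inverse.2 ⟨cosetIndex,
    show ∀ p : Fin 2 × Fin 11, cosetIndex (tableVX p.1 p.2 22) = p by decide +kernel,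
    show ∀ x : Fin 22, tableVX (cosetIndex x).1 (cosetIndex x).2 22 = x by decide +kernel⟩

/-- The matrix whose nine entries, row by row, are the base-4 digits of `n`. -/
def matrixOfCode (n : ℕ) : Matrix (Fin 3) (Fin 3) F4 :=
  fun i j => F4.ofDigit (n / 4 ^ (3 * (i : ℕ) + j))

/-- Codes of the matrices of the Schreier generators that come from `V`. -/
def schreierCodeV : Fin 2 → Fin 11 → ℕ :=
  ![![65793, 121545, 82061, 181156, 55489, 212068, 174029, 90277, 164609, 245609, 199193],
    ![67857, 133925, 54985, 18233, 179812, 163748, 145565, 157961, 19172, 34449, 25617]]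

/-- The permutation with table `t` maps each coset `planeHom.range * (V ^ i * X ^ j)` into a coset
of the same form, as witnessed by the matrices with codes `c i j`. -/
def IsSchreierTable (t : Fin 22 → Fin 22) (c : Fin 2 → Fin 11 → ℕ) : Prop :=
  ∀ (i : Fin 2) (j : Fin 11), (matrixOfCode (c i j)).det = 1 ∧ ∀ k : Fin 22,
    t (tableVX i j k) =
      tableVX (cosetIndex (t (tableVX i j 22))).1 (cosetIndex (t (tableVX i j 22))).2
        (matrixAct (matrixOfCode (c i j)) k)

theorem isSchreierTable_X : IsSchreierTable tableX fun _ _ => 65793 := by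
  unfold IsSchreierTable
  simp only [Matrix.det_fin_three]
  decide +kernel

theorem isSchreierTable_Y : IsSchreierTable tableY fun i _ => ![141072, 147169] i := by
  unfold IsSchreierTable
  simp only [Matrix.det_fin_three]
  decide +kernel

theorem isSchreierTable_V : IsSchreierTable tableV schreierCodeV := by
  unfold IsSchreierTable
  simp only [Matrix.det_fin_three]
  decide +kernel

/-- The permutations of the form `planeHom A * V ^ i * X ^ j`. -/
def planeCosets : Set S22 :=
  {g | ∃ (A : Matrix.SpecialLinearGroup (Fin 3) F4) (p : Fin 2 × Fin 11),
    g = planeHom A * (permV ^ (p.1 : ℕ) * permX ^ (p.2 : ℕ))}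

theorem mul_mem_planeCosets {t : Fin 22 → Fin 22} {c : Fin 2 → Fin 11 → ℕ}
    (h : IsSchreierTable t c) {s : S22} (hs : ∀ k, S22.image k s = t k) {g : S22}
    (hg : g ∈ planeCosets) : g * s ∈ planeCosets := by
  obtain ⟨A, ⟨i, j⟩, rfl⟩ := hg
  obtain ⟨hdet, hk⟩ := h i j
  let B : Matrix.SpecialLinearGroup (Fin 3) F4 := ⟨_, hdet⟩
  refine ⟨A * B, cosetIndex (t (tableVX i j 22)), ?_⟩
  rw [map_mul planeHom A B, mul_assoc (planeHom A), mul_assoc (planeHom A)]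
  congr 1
  apply S22.ext_image
  intro k
  rw [S22.image_mul, hs, image_permV_pow_mul_permX_pow, S22.image_mul,
    image_permV_pow_mul_permX_pow, image_planeHom]
  exact hk k

instance : Finite S22 := Finite.of_injective MulOpposite.unop MulOpposite.unop_injective

theorem M22_subset_planeCosets {g : S22} (hg : g ∈ M22) : g ∈ planeCosets := by
  have hg' : g ∈ Submonoid.closure {permX, permY, permV} := by
    rwa [← Subgroup.closure_toSubmonoid_of_finite]
  induction hg' using Submonoid.closure_induction_right with
  | one => exact ⟨1, 0, by simp⟩
  | mul_right x hx y hy ih =>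
    have hx' := ih (by rwa [M22, ← Subgroup.mem_toSubmonoid, Subgroup.closure_toSubmonoid_of_finite])
    rcases hy with rfl | rfl | rfl
    · exact mul_mem_planeCosets isSchreierTable_X image_permX hx'
    · exact mul_mem_planeCosets isSchreierTable_Y image_permY hx'
    · exact mul_mem_planeCosets isSchreierTable_V image_permV hx'

theorem mem_range_planeHom_of_mem_M22 {g : S22} (hg : g ∈ M22) (h : S22.image 22 g = 22) :
    g ∈ planeHom.range := by
  obtain ⟨A, p, rfl⟩ := M22_subset_planeCosets hg
  rw [S22.image_mul, image_zero_planeHom, image_permV_pow_mul_permX_pow] at h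
  obtain rfl : p = 0 := tableVX_bijective.1 h
  exact ⟨A, by simp⟩

theorem IsOGSWith.hasOGS {G : Type*} [Group G] {n : ℕ} {a : Fin n → G} {m : Fin n → ℕ}
    (h : IsOGSWith a m) : HasOGS G := ⟨n, a, m, h⟩

theorem List.prod_ofFn_append_pair_pow {G : Type*} [Group G] (H : Subgroup G) (v x : G) {n : ℕ}
    (a : Fin n → H) (i : Fin (n + 2) → ℕ) :
    (List.ofFn fun k => (Fin.append (fun k => (a k : G)) ![v, x]) k ^ i k).prod =
      ((List.ofFn fun k => a k ^ i (Fin.castAdd 2 k)).prod : H) * v ^ i (Fin.natAdd n 0) *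
        x ^ i (Fin.natAdd n 1) := by
  rw [List.ofFn_add, List.prod_append, Subgroup.val_list_prod, List.map_ofFn, mul_assoc]
  congr 1
  · congr 2
    funext k
    simp only [Function.comp_apply, SubmonoidClass.coe_pow,
      ← Fin.append_left (fun k => (a k : G)) ![v, x] k]
    rfl
  · simp [List.ofFn_succ]

/-- An ordered generating system of a subgroup `H`, followed by `v` and `x`, is an ordered
generating system if the products `v ^ i * x ^ j` with `i ≤ r` and `j ≤ s` are a transversal of
the cosets of `H`. -/
theorem IsOGSWith.append_pair {G : Type*} [Group G] {H : Subgroup G} {v x : G} {r s : ℕ}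
    (htr : ∀ g : G, ∃! p : H × Fin (r + 1) × Fin (s + 1),
      g = (p.1 : G) * v ^ (p.2.1 : ℕ) * x ^ (p.2.2 : ℕ))
    {n : ℕ} {a : Fin n → H} {m : Fin n → ℕ} (h : IsOGSWith a m) :
    IsOGSWith (Fin.append (fun k => (a k : G)) ![v, x]) (Fin.append m ![r, s]) := by
  intro g
  obtain ⟨⟨y, j, l⟩, hg, huniq⟩ := htr g
  obtain ⟨e, ⟨heb, hey⟩, heuniq⟩ := h y
  refine ⟨Fin.append e ![(j : ℕ), (l : ℕ)], ⟨?_, ?_⟩, ?_⟩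
  · intro k
    induction k using Fin.addCases with
    | left k => simpa using heb k
    | right k =>
      fin_cases k
      · simpa using Nat.le_of_lt_succ j.2
      · simpa using Nat.le_of_lt_succ l.2
  · rw [List.prod_ofFn_append_pair_pow]
    simpa [← hey] using hg
  · rintro i ⟨hib, hi⟩
    rw [List.prod_ofFn_append_pair_pow] at hi
    have hj : i (Fin.natAdd n 0) < r + 1 := by
      have := hib (Fin.natAdd n 0)
      simp only [Fin.append_right, Matrix.cons_val_zero] at this
      omega
    have hl : i (Fin.natAdd n 1) < s + 1 := by
      have := hib (Fin.natAdd n 1)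
      simp only [Fin.append_right, Matrix.cons_val_one] at this
      simpa using Nat.lt_succ_of_le this
    have heq := huniq ⟨_, ⟨_, hj⟩, ⟨_, hl⟩⟩ hi
    simp only [Prod.mk.injEq] at heq
    obtain ⟨h1, rfl, rfl⟩ := heq
    have h2 := heuniq (fun k => i (Fin.castAdd 2 k))
      ⟨fun k => by simpa using hib (Fin.castAdd 2 k), h1.symm⟩
    funext k
    induction k using Fin.addCases with
    | left k => simpa using congrFun h2 k
    | right k => fin_cases k <;> simp

/-- The permutation `Y` as an element of `M₂₂`. -/
def M22.Y : M22 := ⟨permY, Subgroup.subset_closure (by simp)⟩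

/-- The product of the elements `V ^ i * X ^ j * Y ^ l` for the triples `(i, j, l)` in a list. -/
def wordPerm (w : List (ℕ × ℕ × ℕ)) : M22 :=
  (w.map fun e => M22.V ^ e.1 * M22.X ^ e.2.1 * M22.Y ^ e.2.2).prod

/-- The image of `x` under `wordPerm w`. -/
def wordTable (w : List (ℕ × ℕ × ℕ)) (x : Fin 22) : Fin 22 :=
  w.foldl (fun y e => tableY^[e.2.2] (tableX^[e.2.1] (tableV^[e.1] y))) x

theorem image_wordPerm (w : List (ℕ × ℕ × ℕ)) (x : Fin 22) :
    S22.image x (wordPerm w : S22) = wordTable w x := by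
  induction w generalizing x with
  | nil => rfl
  | cons e w ih =>
    change S22.image x ((permV ^ e.1 * permX ^ e.2.1 * permY ^ e.2.2) * (wordPerm w : S22)) = _
    rw [S22.image_mul, ih, S22.image_mul, S22.image_mul, image_permV_pow, image_permX_pow,
      image_permY_pow]
    rfl

/-- Words for the elements of an ordered generating system of the stabilizer of the point `22`.
It is adapted to the chain of stabilizers of the points `1`, `7` and `16`. -/
def stabWord : Fin 9 → List (ℕ × ℕ × ℕ) :=
  ![[(3, 1, 0), (1, 1, 0)],
    [(1, 1, 0), (1, 1, 0)],
    [(2, 0, 0)],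
    [(0, 7, 0), (1, 4, 0), (1, 4, 0)],
    [(0, 2, 0), (1, 10, 0), (1, 10, 0), (1, 8, 0)],
    [(0, 5, 0), (3, 8, 3)],
    [(0, 8, 0), (1, 6, 0), (1, 5, 2)],
    [(0, 0, 1)],
    [(0, 9, 0), (1, 10, 0)]]

/-- The exponent bounds that belong to `stabWord`. -/
def stabBound : Fin 9 → ℕ := ![2, 1, 1, 1, 1, 3, 4, 2, 6]

/-- The elements of an ordered generating system of the stabilizer of the point `22`. -/
def stabGen (k : Fin 9) : M22.stab22 :=
  ⟨wordPerm (stabWord k), (image_wordPerm _ _).trans <| by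
    revert k
    decide +kernel⟩

theorem image_stabGen_pow (x : Fin 22) (k : Fin 9) (n : ℕ) :
    S22.image x (((stabGen k ^ n : M22.stab22) : M22) : S22) = (wordTable (stabWord k))^[n] x := by
  rw [SubmonoidClass.coe_pow, SubmonoidClass.coe_pow, S22.image_pow]
  congr 1
  funext y
  exact image_wordPerm _ _

/-- The inclusion of the stabilizer of the point `22` into `S₂₂`. -/
def stabInclusion : M22.stab22 →* S22 := M22.subtype.comp M22.stab22.subtype

theorem stabInclusion_injective : Function.Injective stabInclusion :=
  Subtype.val_injective.comp Subtype.val_injective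

theorem image_stabInclusion_stabGen_pow (x : Fin 22) (k : Fin 9) (n : ℕ) :
    S22.image x (stabInclusion (stabGen k ^ n)) = (wordTable (stabWord k))^[n] x :=
  image_stabGen_pow x k n

/-- The exponents up to the bounds `stabBound`, grouped by the levels of the chain of
stabilizers. -/
abbrev StabExponents : Type :=
  ((Fin 3 × (Fin 2 × Fin 2 × Fin 2 × Fin 2)) × (Fin 4 × Fin 5)) × (Fin 3 × Fin 7)

theorem stabWord_fix_sixteen (n : ℕ) : (wordTable (stabWord 0))^[n] 16 = 16 :=
  Function.iterate_fixed (by decide +kernel) n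

theorem stabWord_fix_seven (k : Fin 9) (hk : k ≤ 4) (n : ℕ) :
    (wordTable (stabWord k))^[n] 7 = 7 :=
  Function.iterate_fixed (by revert k; decide +kernel) n

theorem stabWord_fix_one (k : Fin 9) (hk : k ≤ 6) (n : ℕ) :
    (wordTable (stabWord k))^[n] 1 = 1 :=
  Function.iterate_fixed (by revert k; decide +kernel) n

/-- The powers of the generator that fixes the points `1`, `7` and `16`. -/
def stabFactor0 (e : Fin 3) : M22.stab22 := stabGen 0 ^ (e : ℕ)

/-- The products of generators that move the point `16` and fix `1` and `7`. -/
def stabFactor1 (e : Fin 2 × Fin 2 × Fin 2 × Fin 2) : M22.stab22 :=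
  stabGen 1 ^ (e.1 : ℕ) * stabGen 2 ^ (e.2.1 : ℕ) * stabGen 3 ^ (e.2.2.1 : ℕ) *
    stabGen 4 ^ (e.2.2.2 : ℕ)

/-- The products of generators that move the point `7` and fix `1`. -/
def stabFactor2 (e : Fin 4 × Fin 5) : M22.stab22 := stabGen 5 ^ (e.1 : ℕ) * stabGen 6 ^ (e.2 : ℕ)

/-- The products of generators that move the point `1`. -/
def stabFactor3 (e : Fin 3 × Fin 7) : M22.stab22 := stabGen 7 ^ (e.1 : ℕ) * stabGen 8 ^ (e.2 : ℕ)

theorem image_stabFactor0 (x : Fin 22) (e : Fin 3) :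
    S22.image x (stabInclusion (stabFactor0 e)) = (wordTable (stabWord 0))^[(e : ℕ)] x :=
  image_stabInclusion_stabGen_pow x 0 e

theorem image_stabFactor1 (x : Fin 22) (e : Fin 2 × Fin 2 × Fin 2 × Fin 2) :
    S22.image x (stabInclusion (stabFactor1 e)) =
      (wordTable (stabWord 4))^[(e.2.2.2 : ℕ)] ((wordTable (stabWord 3))^[(e.2.2.1 : ℕ)]
        ((wordTable (stabWord 2))^[(e.2.1 : ℕ)] ((wordTable (stabWord 1))^[(e.1 : ℕ)] x))) := by
  simp only [stabFactor1, map_mul, S22.image_mul, image_stabInclusion_stabGen_pow]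

theorem image_stabFactor2 (x : Fin 22) (e : Fin 4 × Fin 5) :
    S22.image x (stabInclusion (stabFactor2 e)) =
      (wordTable (stabWord 6))^[(e.2 : ℕ)] ((wordTable (stabWord 5))^[(e.1 : ℕ)] x) := by
  simp only [stabFactor2, map_mul, S22.image_mul, image_stabInclusion_stabGen_pow]

theorem image_stabFactor3 (x : Fin 22) (e : Fin 3 × Fin 7) :
    S22.image x (stabInclusion (stabFactor3 e)) =
      (wordTable (stabWord 8))^[(e.2 : ℕ)] ((wordTable (stabWord 7))^[(e.1 : ℕ)] x) := by
  simp only [stabFactor3, map_mul, S22.image_mul, image_stabInclusion_stabGen_pow]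

theorem image_stabFactor0_injective :
    Function.Injective fun e => S22.image 2 (stabInclusion (stabFactor0 e)) := by
  simp only [image_stabFactor0]
  decide +kernel

theorem image_stabFactor1_injective :
    Function.Injective fun e => S22.image 16 (stabInclusion (stabFactor1 e)) := by
  simp only [image_stabFactor1]
  decide +kernel

theorem image_stabFactor2_injective :
    Function.Injective fun e => S22.image 7 (stabInclusion (stabFactor2 e)) := by
  simp only [image_stabFactor2]
  decide +kernel

theorem image_stabFactor3_injective :
    Function.Injective fun e => S22.image 1 (stabInclusion (stabFactor3 e)) := by
  simp only [image_stabFactor3]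
  decide +kernel

/-- The ordered product of powers of the elements `stabGen k`. -/
def stabProd (e : StabExponents) : M22.stab22 :=
  stabFactor0 e.1.1.1 * stabFactor1 e.1.1.2 * stabFactor2 e.1.2 * stabFactor3 e.2

theorem stabProd_injective : Function.Injective stabProd := by
  have h0 : Function.Injective fun e => stabInclusion (stabFactor0 e) := fun a b hab =>
    image_stabFactor0_injective (congrArg (S22.image 2) hab)
  have h1 := S22.mul_injective_of_image 16 h0
    (fun e => by rw [image_stabFactor0, stabWord_fix_sixteen]) image_stabFactor1_injective
  have h2 := S22.mul_injective_of_image 7 h1 (fun e => by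
      rw [S22.image_mul, image_stabFactor0, image_stabFactor1]
      simp only [stabWord_fix_seven _ (show (0 : Fin 9) ≤ 4 by decide),
        stabWord_fix_seven _ (show (1 : Fin 9) ≤ 4 by decide),
        stabWord_fix_seven _ (show (2 : Fin 9) ≤ 4 by decide),
        stabWord_fix_seven _ (show (3 : Fin 9) ≤ 4 by decide),
        stabWord_fix_seven _ (show (4 : Fin 9) ≤ 4 by decide)])
    image_stabFactor2_injective
  have h3 := S22.mul_injective_of_image 1 h2 (fun e => by
      rw [S22.image_mul, S22.image_mul, image_stabFactor0, image_stabFactor1, image_stabFactor2]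
      simp only [stabWord_fix_one _ (show (0 : Fin 9) ≤ 6 by decide),
        stabWord_fix_one _ (show (1 : Fin 9) ≤ 6 by decide),
        stabWord_fix_one _ (show (2 : Fin 9) ≤ 6 by decide),
        stabWord_fix_one _ (show (3 : Fin 9) ≤ 6 by decide),
        stabWord_fix_one _ (show (4 : Fin 9) ≤ 6 by decide),
        stabWord_fix_one _ (show (5 : Fin 9) ≤ 6 by decide),
        stabWord_fix_one _ (show (6 : Fin 9) ≤ 6 by decide)])
    image_stabFactor3_injective
  intro a b hab
  apply h3
  simpa only [stabProd, map_mul] using congrArg stabInclusion hab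

theorem range_stabInclusion : stabInclusion.range = planeHom.range := by
  apply Subgroup.eq_of_le_of_card_ge
  · rintro _ ⟨g, rfl⟩
    exact mem_range_planeHom_of_mem_M22 g.1.2 g.2
  · rw [card_range_planeHom,
      ← Nat.card_congr (MonoidHom.ofInjective stabInclusion_injective).toEquiv]
    have := Nat.card_le_card_of_injective _ stabProd_injective
    simpa using this

theorem card_stab22 : Nat.card M22.stab22 = 20160 := by
  rw [Nat.card_congr (MonoidHom.ofInjective stabInclusion_injective).toEquiv,
    range_stabInclusion, card_range_planeHom]

theorem nonempty_stab22_mulEquiv_PSL :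
    Nonempty (M22.stab22 ≃* Matrix.ProjectiveSpecialLinearGroup (Fin 3) (GaloisField 2 2)) := by
  obtain ⟨e⟩ := nonempty_ringEquiv_F4_galoisField
  exact ⟨(MonoidHom.ofInjective stabInclusion_injective).trans <|
    (MulEquiv.subgroupCongr range_stabInclusion).trans <|
    (QuotientGroup.quotientKerEquivRange planeHom).symm.trans <|
    (QuotientGroup.quotientMulEquivOfEq ker_planeHom).trans <|
    Matrix.ProjectiveSpecialLinearGroup.congrRingEquiv e⟩

theorem stabProd_bijective : Function.Bijective stabProd := by
  have : Finite M22.stab22 := inferInstance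
  rw [Nat.bijective_iff_injective_and_card]
  exact ⟨stabProd_injective, by simp [card_stab22]⟩

theorem prod_ofFn_stabGen_pow (i : Fin 9 → ℕ) (e : StabExponents)
    (h : i = ![(e.1.1.1 : ℕ), e.1.1.2.1, e.1.1.2.2.1, e.1.1.2.2.2.1, e.1.1.2.2.2.2, e.1.2.1, e.1.2.2,
      e.2.1, e.2.2]) :
    (List.ofFn fun k => stabGen k ^ i k).prod = stabProd e := by
  subst h
  simp [List.ofFn_succ, stabProd, stabFactor0, stabFactor1, stabFactor2, stabFactor3, mul_assoc]

theorem isOGSWith_stabGen : IsOGSWith stabGen stabBound := by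
  intro g
  obtain ⟨e, rfl⟩ := stabProd_bijective.2 g
  refine ⟨_, ⟨?_, (prod_ofFn_stabGen_pow _ e rfl).symm⟩, ?_⟩
  · obtain ⟨⟨⟨e0, e1, e2, e3, e4⟩, e5, e6⟩, e7, e8⟩ := e
    intro k
    fin_cases k <;> simp [stabBound] <;> omega
  · rintro i ⟨hib, hi⟩
    simp only [Fin.forall_fin_succ, stabBound] at hib
    simp at hib
    obtain ⟨b0, b1, b2, b3, b4, b5, b6, b7, b8⟩ := hib
    let e' : StabExponents :=
      (((⟨i 0, by omega⟩, ⟨i 1, by omega⟩, ⟨i 2, by omega⟩, ⟨i 3, by omega⟩, ⟨i 4, by omega⟩),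
        ⟨i 5, by omega⟩, ⟨i 6, by omega⟩), ⟨i 7, by omega⟩, ⟨i 8, by omega⟩)
    have hi' : i = ![i 0, i 1, i 2, i 3, i 4, i 5, i 6, i 7, i 8] := by
      funext k
      fin_cases k <;> rfl
    have he : e = e' := stabProd_injective (hi.trans (prod_ofFn_stabGen_pow i e' hi'))
    rw [he]
    exact hi'

theorem image_V_pow_mul_X_pow (i j : ℕ) :
    S22.image 22 ((M22.V ^ i * M22.X ^ j : M22) : S22) = tableVX i j 22 :=
  image_permV_pow_mul_permX_pow 22 i j

/-- The elements `V ^ i * X ^ j` are a transversal of the cosets of the stabilizer of `22`. -/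
theorem existsUnique_stab22_mul (g : M22) : ∃! p : M22.stab22 × Fin 2 × Fin 11,
    g = (p.1 : M22) * M22.V ^ (p.2.1 : ℕ) * M22.X ^ (p.2.2 : ℕ) := by
  have himage : ∀ (h : M22.stab22) (q : Fin 2 × Fin 11),
      S22.image 22 (((h : M22) * (M22.V ^ (q.1 : ℕ) * M22.X ^ (q.2 : ℕ)) : M22) : S22) =
        tableVX q.1 q.2 22 := by
    intro h q
    rw [Subgroup.coe_mul, S22.image_mul, show S22.image 22 ((h : M22) : S22) = 22 from h.2,
      image_V_pow_mul_X_pow]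
  obtain ⟨q, hq⟩ := tableVX_bijective.2 (S22.image 22 (g : S22))
  have hmem : g * (M22.V ^ (q.1 : ℕ) * M22.X ^ (q.2 : ℕ))⁻¹ ∈ M22.stab22 := by
    apply S22.image_injective ((M22.V ^ (q.1 : ℕ) * M22.X ^ (q.2 : ℕ) : M22) : S22)
    change S22.image (S22.image 22 _) _ = S22.image 22 _
    rw [← S22.image_mul, ← Subgroup.coe_mul, inv_mul_cancel_right, image_V_pow_mul_X_pow]
    exact hq.symm
  refine ⟨(⟨_, hmem⟩, q), ?_, ?_⟩
  · simp [mul_assoc]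
  · rintro ⟨h, q'⟩ hg
    rw [mul_assoc] at hg
    dsimp only at hg
    obtain rfl : q' = q := tableVX_bijective.1 <| by
      dsimp only at hq ⊢
      rw [hq, hg, himage]
    refine Prod.ext (Subtype.ext ?_) rfl
    exact eq_mul_inv_of_mul_eq hg.symm

theorem card_M22 : Nat.card M22 = 443520 := by
  have hb : Function.Bijective fun p : M22.stab22 × Fin 2 × Fin 11 =>
      (p.1 : M22) * M22.V ^ (p.2.1 : ℕ) * M22.X ^ (p.2.2 : ℕ) := by
    rw [Function.bijective_iff_existsUnique]
    intro g
    simpa only [eq_comm] using existsUnique_stab22_mul g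
  rw [← Nat.card_congr (Equiv.ofBijective _ hb), Nat.card_prod, card_stab22]
  simp

theorem theorem5 :
    Nat.card M22 = 443520 ∧
    -- the stabilizer of the point 22 is isomorphic to `PSL₃(4)` and has an OGS
    Nonempty (M22.stab22 ≃*
      Matrix.ProjectiveSpecialLinearGroup (Fin 3) (GaloisField 2 2)) ∧
    HasOGS M22.stab22 ∧
    -- the 22 products `V^i X^j` take the point 22 to the 22 different points
    Function.Bijective (fun p : Fin 2 × Fin 11 =>
      S22.image 22 ((M22.V ^ (p.1 : ℕ) * M22.X ^ (p.2 : ℕ) : M22) : S22)) ∧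
    -- they form a transversal of the cosets of the stabilizer
    (∀ g : M22, ∃! p : M22.stab22 × Fin 2 × Fin 11,
      g = (p.1 : M22) * M22.V ^ (p.2.1 : ℕ) * M22.X ^ (p.2.2 : ℕ)) ∧
    -- every OGS of the stabilizer, followed by `V` and `X`, is an OGS of `M₂₂`
    (∀ (n : ℕ) (a : Fin n → M22.stab22) (m : Fin n → ℕ), IsOGSWith a m →
      IsOGSWith (Fin.append (fun k => (a k : M22)) ![M22.V, M22.X]) (Fin.append m ![1, 10])) ∧
    HasOGS M22 := by
  refine ⟨card_M22, nonempty_stab22_mulEquiv_PSL, isOGSWith_stabGen.hasOGS, ?_,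
    existsUnique_stab22_mul, fun _ _ _ h => h.append_pair existsUnique_stab22_mul,
    (isOGSWith_stabGen.append_pair existsUnique_stab22_mul).hasOGS⟩
  simpa only [image_V_pow_mul_X_pow] using tableVX_bijective
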